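/- Let $K\in\mathbb R$ and $N\in(1,\infty)$. For $\kappa\in\mathbb R$ put $s_\kappa(\theta)=\frac{1}{\sqrt{\kappa}}\sin(\sqrt{\kappa}\,\theta)$ if $\kappa>0$, $s_0(\theta)=\theta$, and $s_\kappa(\theta)=\frac1{\sqrt{-\kappa}}\sinh(\sqrt{-\kappa}\,\theta)$ if $\kappa<0$. Let $D_{K,N}=\pi/\sqrt{K/(N-1)}$ if $K>0$ and $D_{K,N}=+\infty$ if $K\le 0$. For a finite $D'\in(0,D_{K,N}]$ let $h_{K,N,D'}:\mathbb R\to[0,\infty)$ be the density $$h_{K,N,D'}(x)=\begin{cases} s_{K/(N-1)}(D'-x)^{N-1}, & x\in[0,D'/2],\\ s_{K/(N-1)}(x)^{N-1}, & x\in[D'/2,D'],\\ 0, & x\notin[0,D'].\end{cases}$$ For a density $h\ge 0$ on $\mathbb R$ let $\lambda[h]$ be the Poincaré constant of $(\mathbb R,|\cdot|,h\,dx)$, $$\lambda[h]=\inf\left\{\frac{\int_{\mathbb R}|\nabla f|^2\,h\,dx}{\int_{\mathbb R}|f|^2\,h\,dx}\;:\; f:\mathbb R\to\mathbb R\text{ locally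 Lipschitz},\ \int_{\mathbb R} f\,h\,dx=0,\ 0<\int_{\mathbb R}|f|^2\,h\,dx<\infty\right\},$$ where $|\nabla f|(x)=\limsup_{y\to x}\frac{|f(y)-f(x)|}{|y-x|}$. Then, on the set of finite $D'\in(0,D_{K,N}]$: 1. if $K\le 0$, the map $D'\mapsto (D')^2\,\lambda[h_{K,N,D'}]$ is non-increasing; 2. if $K\ge 0$, the map $D'\mapsto (D')^2\,\lambda[h_{K,N,D'}]$ is non-decreasing; 3. if $K=0$, the map $D'\mapsto (D')^2\,\lambda[h_{K,N,D'}]$ is constant; 4. if $K\le 0$, the map $D'\mapsto\lambda[h_{K,N,D'}]$ is strictly decreasing on $(0,\infty)$. -/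

import Mathlib

open MeasureTheory Filter Topology
open scoped ENNReal

noncomputable section

/-- The local Lipschitz constant `|∇f|(x) = limsup_{y → x} |f(y) - f(x)| / d(y, x)` of a real
function on a metric space. At an isolated point the filter `𝓝[≠] x` is `⊥`, so the value is `0`. -/
def locLipConst {X : Type*} [MetricSpace X] (f : X → ℝ) (x : X) : ℝ≥0∞ :=
  limsup (fun y => edist (f y) (f x) / edist y x) (𝓝[≠] x)

/-- Admissible test functions for the Poincaré constant of `(X, d, m)`: locally Lipschitz functions
with `∫ f dm = 0` and `0 < ∫ |f|² dm < ∞`. -/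
structure IsPoincareTest {X : Type*} [MetricSpace X] [MeasurableSpace X] (m : Measure X)
    (f : X → ℝ) : Prop where
  locallyLipschitz : LocallyLipschitz f
  integrable : Integrable f m
  integral_eq_zero : ∫ x, f x ∂m = 0
  sq_pos : 0 < ∫⁻ x, ENNReal.ofReal (|f x| ^ 2) ∂m
  sq_lt_top : ∫⁻ x, ENNReal.ofReal (|f x| ^ 2) ∂m < ∞

/-- The Poincaré constant of `(X, d, m)`: the infimum of the Rayleigh quotients
`∫ |∇f|² dm / ∫ |f|² dm` over the admissible test functions. -/
def poincareConst {X : Type*} [MetricSpace X] [MeasurableSpace X] (m : Measure X) : ℝ≥0∞ :=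
  ⨅ (f : X → ℝ) (_ : IsPoincareTest m f),
    (∫⁻ x, locLipConst f x ^ 2 ∂m) / ∫⁻ x, ENNReal.ofReal (|f x| ^ 2) ∂m

/-- `λ[h]`: the Poincaré constant of `(ℝ, |·|, h dx)`, for a non-negative density `h`. -/
def poincareDensity (h : ℝ → ℝ) : ℝ≥0∞ :=
  poincareConst ((volume : Measure ℝ).withDensity fun x => ENNReal.ofReal (h x))

/-- The function `s_κ`. -/
def sFun (κ θ : ℝ) : ℝ :=
  if 0 < κ then 1 / √κ * Real.sin (√κ * θ)
  else if κ = 0 then θ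
  else 1 / √(-κ) * Real.sinh (√(-κ) * θ)

/-- The Bonnet–Myers diameter bound `D_{K,N}`. -/
def bonnetMyers (K N : ℝ) : EReal :=
  if 0 < K then ((Real.pi / √(K / (N - 1)) : ℝ) : EReal) else ⊤

/-- The interval `(0, D_{K,N}]` of finite positive lengths (it is `(0, ∞)` when `K ≤ 0`). -/
def lengthRange (K N : ℝ) : Set ℝ :=
  {D : ℝ | 0 < D ∧ (D : EReal) ≤ bonnetMyers K N}

/-- The model density `h_{K,N,D}`, supported on `[0, D]`. -/
def modelDensity (K N D x : ℝ) : ℝ :=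
  if x ∈ Set.Icc 0 (D / 2) then sFun (K / (N - 1)) (D - x) ^ (N - 1)
  else if x ∈ Set.Icc (D / 2) D then sFun (K / (N - 1)) x ^ (N - 1)
  else 0

end

/-! The model density is symmetric about `D / 2`. Subtracting `f (D / 2)` from a mean-zero `f` does
not decrease its L² norm and splits the problem into two halves vanishing at the centre; conversely,
odd extension turns a function on one half into a test function. After rescaling, `D² λ` is
therefore the best constant in a weighted Poincaré inequality on `(0, 1/2)` for functions vanishing
at `0` (`HalfPoincare.le_poincareDensity`, `halfPoincare_poincareDensity`).

Multiplying the weight by a non-increasing factor preserves such an inequality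
(`HalfPoincare.antitone_mul`): by the layer-cake formula it suffices to treat initial segments,
where one tests with `f` stopped at the endpoint. The weights for two lengths differ by a power of a
ratio of values of `sFun`, and a Wronskian computation makes this ratio monotone, in a direction
fixed by the sign of `K`. For `K ≤ 0`, strict decrease of `λ` follows from `0 < λ < ∞` and the
strict growth of `D²`. -/

/-! ### Local Lipschitz constants and derivatives on the line. -/

lemma LocallyLipschitz.exists_lipschitzOnWith_Icc {f : ℝ → ℝ} (hf : LocallyLipschitz f) (a b : ℝ) :
    ∃ C, LipschitzOnWith C f (Set.Icc a b) :=
  hf.locallyLipschitzOn.exists_lipschitzOnWith_of_compact isCompact_Icc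

lemma LocallyLipschitz.ae_differentiableAt_real {f : ℝ → ℝ} (hf : LocallyLipschitz f) :
    ∀ᵐ x, DifferentiableAt ℝ f x := by
  refine LocallyBoundedVariationOn.ae_differentiableAt fun a b _ _ => ?_
  rcases le_total a b with hab | hab
  · obtain ⟨C, hC⟩ := hf.exists_lipschitzOnWith_Icc a b
    simpa using hC.locallyBoundedVariationOn a b (Set.left_mem_Icc.2 hab) (Set.right_mem_Icc.2 hab)
  -- For `b ≤ a` the interval `Icc a b` contains at most the point `a`.
  · refine BoundedVariationOn.mono (s := {a}) (by simp [BoundedVariationOn]) ?_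
    rintro x ⟨-, h1, h2⟩
    exact le_antisymm (h2.trans hab) h1

lemma locLipConst_eq_enorm_deriv {f : ℝ → ℝ} {x : ℝ} (hf : DifferentiableAt ℝ f x) :
    locLipConst f x = ‖deriv f x‖ₑ := by
  refine Tendsto.limsup_eq ?_
  have h := (hasDerivAt_iff_tendsto_slope.1 hf.hasDerivAt).enorm
  refine h.congr' ?_
  filter_upwards [self_mem_nhdsWithin] with y hy
  have hy : y - x ≠ 0 := sub_ne_zero.2 hy
  rw [slope_def_field, edist_eq_enorm_sub, edist_eq_enorm_sub, div_eq_mul_inv, enorm_mul,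
    enorm_inv hy, ENNReal.div_eq_inv_mul, mul_comm]

lemma LocallyLipschitz.locLipConst_ae_eq {f : ℝ → ℝ} (hf : LocallyLipschitz f) :
    locLipConst f =ᵐ[volume] fun x => ‖deriv f x‖ₑ := by
  filter_upwards [hf.ae_differentiableAt_real] with x hx using locLipConst_eq_enorm_deriv hx

lemma ofReal_abs_sq (r : ℝ) : ENNReal.ofReal (|r| ^ 2) = ‖r‖ₑ ^ 2 := by
  rw [ENNReal.ofReal_pow (abs_nonneg r), Real.enorm_eq_ofReal_abs]

/-! ### One-sided weighted Poincaré inequalities. -/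

/-- The Poincaré inequality with constant `C` on `(0, 1/2)` with weight `u`, for functions which
vanish at `0`. -/
def HalfPoincare (C : ℝ≥0∞) (u : ℝ → ℝ≥0∞) : Prop :=
  ∀ f : ℝ → ℝ, LocallyLipschitz f → f 0 = 0 →
    C * ∫⁻ t in Set.Ioo 0 (1 / 2), u t * ‖f t‖ₑ ^ 2 ≤
      ∫⁻ t in Set.Ioo 0 (1 / 2), u t * ‖deriv f t‖ₑ ^ 2

lemma HalfPoincare.congr {C : ℝ≥0∞} {u v : ℝ → ℝ≥0∞} (h : HalfPoincare C u)
    (huv : Set.EqOn u v (Set.Ioo 0 (1 / 2))) : HalfPoincare C v := by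
  intro f hf hf0
  have e (g : ℝ → ℝ≥0∞) : ∫⁻ t in Set.Ioo 0 (1 / 2), v t * g t
      = ∫⁻ t in Set.Ioo 0 (1 / 2), u t * g t :=
    setLIntegral_congr_fun measurableSet_Ioo fun t ht => by simp only [huv ht]
  rw [e, e]
  exact h f hf hf0

/-- Stopping `f` at `c` keeps it admissible and kills its derivative beyond `c`, while the left side
only loses mass when cut down to `(0, c)`. -/
lemma HalfPoincare.initial_segment {C : ℝ≥0∞} {u : ℝ → ℝ≥0∞} (h : HalfPoincare C u) {c : ℝ}
    (hc : c ∈ Set.Icc (0 : ℝ) (1 / 2)) {f : ℝ → ℝ} (hf : LocallyLipschitz f) (hf0 : f 0 = 0) :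
    C * ∫⁻ t in Set.Ioo 0 c, u t * ‖f t‖ₑ ^ 2 ≤ ∫⁻ t in Set.Ioo 0 c, u t * ‖deriv f t‖ₑ ^ 2 := by
  have hg : LocallyLipschitz fun t => f (min t c) :=
    hf.comp (LipschitzWith.id.min_const c).locallyLipschitz
  have key := h _ hg (by simp [hc.1, hf0])
  have hsub : Set.Ioo 0 c ⊆ Set.Ioo (0 : ℝ) (1 / 2) := Set.Ioo_subset_Ioo_right hc.2
  calc C * ∫⁻ t in Set.Ioo 0 c, u t * ‖f t‖ₑ ^ 2
      = C * ∫⁻ t in Set.Ioo 0 c, u t * ‖f (min t c)‖ₑ ^ 2 := by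
        congr 1
        refine setLIntegral_congr_fun measurableSet_Ioo fun t ht => ?_
        simp only [min_eq_left ht.2.le]
    _ ≤ C * ∫⁻ t in Set.Ioo 0 (1 / 2), u t * ‖f (min t c)‖ₑ ^ 2 := by
        gcongr
    _ ≤ _ := key
    _ ≤ ∫⁻ t in Set.Ioo 0 (1 / 2),
          (Set.Ioo 0 c).indicator (fun t => u t * ‖deriv f t‖ₑ ^ 2) t := by
        refine lintegral_mono_ae ?_
        have hne : ∀ᵐ t ∂(volume.restrict (Set.Ioo (0 : ℝ) (1 / 2))), t ≠ c :=
          Measure.ae_ne _ c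
        filter_upwards [hne, ae_restrict_mem measurableSet_Ioo] with t htc ht
        rcases lt_or_gt_of_ne htc with hlt | hlt
        · rw [Set.indicator_of_mem (show t ∈ Set.Ioo 0 c from ⟨ht.1, hlt⟩)]
          have : (fun t => f (min t c)) =ᶠ[𝓝 t] f := by
            filter_upwards [Iio_mem_nhds hlt] with s hs
            rw [min_eq_left (le_of_lt hs)]
          rw [this.deriv_eq]
        · have : (fun t => f (min t c)) =ᶠ[𝓝 t] fun _ => f c := by
            filter_upwards [Ioi_mem_nhds hlt] with s hs
            rw [min_eq_right (le_of_lt hs)]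
          rw [this.deriv_eq]
          simp
    _ = _ := by
        rw [setLIntegral_indicator measurableSet_Ioo, Set.inter_eq_left.2 hsub]

/-- A weighted Poincaré inequality on `(0, 1/2)` for functions vanishing at `0` persists when the
weight is multiplied by a non-increasing function. -/
lemma HalfPoincare.antitone_mul {C : ℝ≥0∞} {u : ℝ → ℝ≥0∞} (h : HalfPoincare C u)
    (hu : Measurable u) {φ : ℝ → ℝ} (hφ : AntitoneOn φ (Set.Ioo 0 (1 / 2)))
    (hφ0 : ∀ t ∈ Set.Ioo (0 : ℝ) (1 / 2), 0 ≤ φ t) :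
    HalfPoincare C fun t => ENNReal.ofReal (φ t) * u t := by
  intro f hf hf0
  -- Layer cake: `φ` is the integral over `r` of the indicators of its superlevel sets, which
  -- reduces the claim to each such set.
  have cake (g : ℝ → ℝ≥0∞) (hg : Measurable g) :
      ∫⁻ t in Set.Ioo 0 (1 / 2), ENNReal.ofReal (φ t) * u t * g t =
      ∫⁻ r in Set.Ioi 0, ∫⁻ t in {t | r < φ t} ∩ Set.Ioo 0 (1 / 2), u t * g t := by
    set μ := (volume.restrict (Set.Ioo (0 : ℝ) (1 / 2))).withDensity fun t => u t * g t with hμ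
    have hac : μ ≪ volume.restrict (Set.Ioo (0 : ℝ) (1 / 2)) := withDensity_absolutelyContinuous _ _
    have hφm : AEMeasurable φ (volume.restrict (Set.Ioo (0 : ℝ) (1 / 2))) :=
      aemeasurable_restrict_of_antitoneOn measurableSet_Ioo hφ
    have h1 := lintegral_eq_lintegral_meas_lt μ (f := φ)
      (hac.ae_le ((ae_restrict_mem measurableSet_Ioo).mono fun t ht => hφ0 t ht))
      (hφm.mono_ac hac)
    rw [hμ, lintegral_withDensity_eq_lintegral_mul₀ (f := fun t => u t * g t) (hu.mul hg).aemeasurable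
      hφm.ennreal_ofReal] at h1
    calc _ = _ := lintegral_congr fun t => by simp only [Pi.mul_apply]; ring
      _ = _ := h1
      _ = _ := by
        refine lintegral_congr fun r => ?_
        have hs : NullMeasurableSet {t | r < φ t} (volume.restrict (Set.Ioo (0 : ℝ) (1 / 2))) :=
          nullMeasurableSet_lt aemeasurable_const hφm
        rw [withDensity_apply₀ _ hs, Measure.restrict_restrict₀ hs]
  rw [cake _ (by have := hf.continuous.measurable; fun_prop),
    cake _ (by have := measurable_deriv f; fun_prop)]
  refine (lintegral_const_mul_le _ _).trans (lintegral_mono fun r => ?_)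
  set S := {t | r < φ t} ∩ Set.Ioo (0 : ℝ) (1 / 2) with hS
  have hdown : ∀ t ∈ S, Set.Ioc 0 t ⊆ S := fun t ht s hs =>
    ⟨lt_of_lt_of_le ht.1 (hφ ⟨hs.1, hs.2.trans_lt ht.2.2⟩ ht.2 hs.2), hs.1, hs.2.trans_lt ht.2.2⟩
  have hbdd : BddAbove S := ⟨1 / 2, fun t ht => ht.2.2.le⟩
  -- A superlevel set of a non-increasing function is an initial segment; whether it contains its
  -- supremum is irrelevant up to null sets.
  obtain ⟨c, hc, hSc⟩ : ∃ c ∈ Set.Icc (0 : ℝ) (1 / 2), S =ᵐ[volume] Set.Ioo 0 c := by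
    rcases S.eq_empty_or_nonempty with h0 | hne
    · exact ⟨0, by norm_num, by simp [h0]⟩
    · refine ⟨sSup S, ⟨?_, csSup_le hne fun t ht => ht.2.2.le⟩, ?_⟩
      · obtain ⟨t, ht⟩ := hne
        exact ht.2.1.le.trans (le_csSup hbdd ht)
      · have h1 : Set.Ioo 0 (sSup S) ⊆ S := fun t ht => by
          obtain ⟨s, hs, hts⟩ := exists_lt_of_lt_csSup hne ht.2
          exact hdown s hs ⟨ht.1, hts.le⟩
        have h2 : S ⊆ Set.Ioc 0 (sSup S) := fun t ht => ⟨ht.2.1, le_csSup hbdd ht⟩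
        exact (h2.eventuallyLE.trans Ioo_ae_eq_Ioc.symm.le).antisymm h1.eventuallyLE
  rw [setLIntegral_congr hSc, setLIntegral_congr hSc]
  exact h.initial_segment hc hf hf0

/-! ### The model density and its measure. -/

lemma continuous_sFun (κ : ℝ) : Continuous (sFun κ) := by
  unfold sFun
  split_ifs <;> fun_prop

lemma continuous_sFun_rpow {N : ℝ} (hN : 1 < N) (κ : ℝ) :
    Continuous fun x => sFun κ x ^ (N - 1) :=
  (continuous_sFun κ).rpow_const fun _ => Or.inr (by linarith)

lemma modelDensity_eq_indicator (K N D : ℝ) :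
    modelDensity K N D =
      (Set.Icc 0 D).indicator fun x => sFun (K / (N - 1)) (max x (D - x)) ^ (N - 1) := by
  ext x
  unfold modelDensity
  split_ifs with h1 h2
  · rw [Set.indicator_of_mem (show x ∈ Set.Icc 0 D from ⟨h1.1, by linarith [h1.1, h1.2]⟩),
      max_eq_right (by linarith [h1.2])]
  · rw [Set.indicator_of_mem (show x ∈ Set.Icc 0 D from ⟨by linarith [h2.1, h2.2], h2.2⟩),
      max_eq_left (by linarith [h2.1])]
  · rw [Set.indicator_of_notMem]
    rintro ⟨h3, h4⟩
    rcases le_total x (D / 2) with h | h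
    exacts [h1 ⟨h3, h⟩, h2 ⟨h, h4⟩]

lemma integrable_modelDensity {N : ℝ} (hN : 1 < N) (K D : ℝ) :
    Integrable (modelDensity K N D) := by
  rw [modelDensity_eq_indicator, integrable_indicator_iff measurableSet_Icc]
  exact ((continuous_sFun_rpow hN _).comp (by fun_prop :
    Continuous fun x : ℝ => max x (D - x))).integrableOn_Icc

lemma measurable_modelDensity {N : ℝ} (hN : 1 < N) (K D : ℝ) :
    Measurable (modelDensity K N D) := by
  rw [modelDensity_eq_indicator]
  exact ((continuous_sFun_rpow hN _).comp (by fun_prop :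
    Continuous fun x : ℝ => max x (D - x))).measurable.indicator measurableSet_Icc

lemma modelDensity_reflect (K N D x : ℝ) : modelDensity K N D (D - x) = modelDensity K N D x := by
  simp only [modelDensity_eq_indicator, Set.indicator_apply, sub_sub_cancel, max_comm (D - x) x]
  congr 1
  simp only [Set.mem_Icc, eq_iff_iff]
  constructor <;> rintro ⟨h1, h2⟩ <;> constructor <;> linarith

/-- The metric measure space structure on `ℝ` given by the model density. -/
noncomputable def modelMeasure (K N D : ℝ) : Measure ℝ :=
  (volume : Measure ℝ).withDensity fun x => ENNReal.ofReal (modelDensity K N D x)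

/-- The right half of the model density, rescaled to `(0, 1/2)`. -/
noncomputable def halfWeight (K N D t : ℝ) : ℝ≥0∞ :=
  ENNReal.ofReal (sFun (K / (N - 1)) (D * (1 / 2 + t)) ^ (N - 1))

lemma measurable_halfWeight {N : ℝ} (hN : 1 < N) (K D : ℝ) : Measurable (halfWeight K N D) :=
  ((continuous_sFun_rpow hN _).comp (by fun_prop :
    Continuous fun t : ℝ => D * (1 / 2 + t))).measurable.ennreal_ofReal

lemma isFiniteMeasure_modelMeasure {N : ℝ} (hN : 1 < N) (K D : ℝ) :
    IsFiniteMeasure (modelMeasure K N D) :=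
  isFiniteMeasure_withDensity_ofReal (integrable_modelDensity hN K D).2

lemma modelMeasure_absolutelyContinuous (K N D : ℝ) : modelMeasure K N D ≪ volume :=
  withDensity_absolutelyContinuous _ _

lemma modelMeasure_restrict_Icc (K N D : ℝ) :
    (modelMeasure K N D).restrict (Set.Icc 0 D) = modelMeasure K N D := by
  rw [modelMeasure, restrict_withDensity measurableSet_Icc, ← withDensity_indicator measurableSet_Icc]
  congr 1
  ext x
  by_cases hx : x ∈ Set.Icc 0 D <;> simp [modelDensity_eq_indicator, hx]

lemma integrable_modelMeasure {N : ℝ} (hN : 1 < N) (K D : ℝ) {f : ℝ → ℝ} (hf : Continuous f) :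
    Integrable f (modelMeasure K N D) := by
  have := isFiniteMeasure_modelMeasure hN K D
  rw [← modelMeasure_restrict_Icc K N D]
  exact hf.integrableOn_Icc

lemma integral_eq_zero_of_reflect {N : ℝ} (hN : 1 < N) (K D : ℝ) {f : ℝ → ℝ}
    (hf : ∀ x, f (D - x) = -f x) : ∫ x, f x ∂modelMeasure K N D = 0 := by
  rw [modelMeasure, integral_withDensity_eq_integral_toReal_smul
    (measurable_modelDensity hN K D).ennreal_ofReal (by simp)]
  have h := integral_sub_left_eq_self
    (fun x => (ENNReal.ofReal (modelDensity K N D x)).toReal • f x) volume D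
  simp only [modelDensity_reflect, hf, smul_neg, integral_neg] at h
  linarith

lemma setLIntegral_affine {a d : ℝ} (hd : d ≠ 0) {s : Set ℝ} (hs : MeasurableSet s) (g : ℝ → ℝ≥0∞) :
    ∫⁻ x in (fun t => a + d * t) '' s, g x =
      ENNReal.ofReal |d| * ∫⁻ t in s, g (a + d * t) := by
  rw [lintegral_image_eq_lintegral_abs_deriv_mul (f' := fun _ => d) hs, lintegral_const_mul' _ _
    ENNReal.ofReal_ne_top]
  · intro x _
    simpa using (((hasDerivAt_id x).const_mul d).const_add a).hasDerivWithinAt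
  · intro x _ y _ h
    simpa [hd] using h

/-- Folding at the midpoint: by symmetry of the density both halves carry the same rescaled weight.
-/
lemma lintegral_modelMeasure {N D : ℝ} (hN : 1 < N) (hD : 0 < D) (K : ℝ) (g : ℝ → ℝ≥0∞) :
    ∫⁻ x, g x ∂modelMeasure K N D =
      ENNReal.ofReal D *
        ((∫⁻ t in Set.Ioo 0 (1 / 2), halfWeight K N D t * g (D / 2 + D * t)) +
          ∫⁻ t in Set.Ioo 0 (1 / 2), halfWeight K N D t * g (D / 2 + -D * t)) := by
  set p : ℝ → ℝ := fun x => sFun (K / (N - 1)) (max x (D - x)) ^ (N - 1) with hp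
  have hL : Set.Ioo 0 (D / 2) = (fun t => D / 2 + -D * t) '' Set.Ioo 0 (1 / 2) := by
    ext x
    constructor
    · rintro ⟨h1, h2⟩
      refine ⟨(D / 2 - x) / D, ⟨by apply div_pos <;> linarith, ?_⟩, by field_simp; ring⟩
      rw [div_lt_iff₀ hD]; linarith
    · rintro ⟨t, ⟨h1, h2⟩, rfl⟩
      constructor <;> dsimp only <;> nlinarith
  have hR : Set.Ioo (D / 2) D = (fun t => D / 2 + D * t) '' Set.Ioo 0 (1 / 2) := by
    ext x
    constructor
    · rintro ⟨h1, h2⟩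
      refine ⟨(x - D / 2) / D, ⟨by apply div_pos <;> linarith, ?_⟩, by field_simp; ring⟩
      rw [div_lt_iff₀ hD]; linarith
    · rintro ⟨t, ⟨h1, h2⟩, rfl⟩
      constructor <;> dsimp only <;> nlinarith
  have hun : Set.Icc 0 D =ᵐ[volume] (Set.Ioo 0 (D / 2) ∪ Set.Ioo (D / 2) D : Set ℝ) := by
    refine Ioo_ae_eq_Icc.symm.trans ?_
    have h : Set.Ioo (0 : ℝ) D \ {D / 2} = Set.Ioo 0 (D / 2) ∪ Set.Ioo (D / 2) D := by
      ext x
      simp only [Set.mem_sdiff, Set.mem_Ioo, Set.mem_singleton_iff, Set.mem_union]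
      grind
    rw [← h]
    exact (sdiff_null_ae_eq_self (measure_singleton _)).symm
  rw [modelMeasure, lintegral_withDensity_eq_lintegral_mul_non_measurable _
    (measurable_modelDensity hN K D).ennreal_ofReal (by simp)]
  calc ∫⁻ x, ((fun x => ENNReal.ofReal (modelDensity K N D x)) * g) x
      = ∫⁻ x, (Set.Icc 0 D).indicator (fun x => ENNReal.ofReal (p x) * g x) x := by
        refine lintegral_congr fun x => ?_
        by_cases hx : x ∈ Set.Icc 0 D <;> simp [modelDensity_eq_indicator, hx, hp]
    _ = (∫⁻ x in Set.Ioo (D / 2) D, ENNReal.ofReal (p x) * g x) +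
          ∫⁻ x in Set.Ioo 0 (D / 2), ENNReal.ofReal (p x) * g x := by
        rw [lintegral_indicator measurableSet_Icc, setLIntegral_congr hun,
          lintegral_union measurableSet_Ioo, add_comm]
        exact Set.disjoint_left.2 fun x h1 h2 => absurd h1.2 (not_lt.2 h2.1.le)
    _ = _ := by
        rw [hL, hR, setLIntegral_affine hD.ne' measurableSet_Ioo,
          setLIntegral_affine (neg_ne_zero.2 hD.ne') measurableSet_Ioo, abs_neg, abs_of_pos hD,
          ← mul_add]
        congr 2
        · refine setLIntegral_congr_fun measurableSet_Ioo fun t ht => ?_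
          have : 0 < D * t := mul_pos hD ht.1
          simp only [hp, halfWeight]
          rw [max_eq_left (by linarith), show D * (1 / 2 + t) = D / 2 + D * t by ring]
        · refine setLIntegral_congr_fun measurableSet_Ioo fun t ht => ?_
          have : 0 < D * t := mul_pos hD ht.1
          simp only [hp, halfWeight]
          rw [max_eq_right (by linarith), show D * (1 / 2 + t) = D - (D / 2 + -D * t) by ring]

/-! ### Reduction of the Poincaré constant to the half-interval problem. -/

lemma poincareDensity_modelDensity (K N D : ℝ) :
    poincareDensity (modelDensity K N D) = poincareConst (modelMeasure K N D) := rfl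

lemma lintegral_locLipConst_modelMeasure {f : ℝ → ℝ} (hf : LocallyLipschitz f) (K N D : ℝ) :
    ∫⁻ x, locLipConst f x ^ 2 ∂modelMeasure K N D = ∫⁻ x, ‖deriv f x‖ₑ ^ 2 ∂modelMeasure K N D := by
  refine lintegral_congr_ae ?_
  filter_upwards [(modelMeasure_absolutelyContinuous K N D).ae_le hf.locLipConst_ae_eq] with x hx
  rw [hx]

lemma lintegral_enorm_sq_eq {μ : Measure ℝ} {f : ℝ → ℝ} (hf : Integrable (fun x => f x ^ 2) μ) :
    ∫⁻ x, ‖f x‖ₑ ^ 2 ∂μ = ENNReal.ofReal (∫ x, f x ^ 2 ∂μ) := by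
  rw [ofReal_integral_eq_lintegral_ofReal hf (ae_of_all _ fun x => sq_nonneg _)]
  exact lintegral_congr fun x => by rw [← ofReal_abs_sq, sq_abs]

/-- The mean minimizes the quadratic deviation. -/
lemma lintegral_enorm_sq_le_of_integral_eq_zero {μ : Measure ℝ} [IsFiniteMeasure μ] {f : ℝ → ℝ}
    (hf : Integrable f μ) (hf2 : Integrable (fun x => f x ^ 2) μ) (h0 : ∫ x, f x ∂μ = 0) (c : ℝ) :
    ∫⁻ x, ‖f x‖ₑ ^ 2 ∂μ ≤ ∫⁻ x, ‖f x - c‖ₑ ^ 2 ∂μ := by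
  have e : (fun x => (f x - c) ^ 2) = fun x => f x ^ 2 - 2 * c * f x + c ^ 2 := by
    ext x; ring
  have hs : Integrable (fun x => f x ^ 2 - 2 * c * f x) μ := hf2.sub (hf.const_mul _)
  have hi : Integrable (fun x => (f x - c) ^ 2) μ := by
    rw [e]
    exact hs.add (integrable_const _)
  rw [lintegral_enorm_sq_eq hf2, lintegral_enorm_sq_eq hi]
  refine ENNReal.ofReal_le_ofReal ?_
  rw [e, integral_add hs (integrable_const _),
    integral_sub hf2 (hf.const_mul _), integral_const_mul, h0]
  simp only [mul_zero, sub_zero, integral_const, smul_eq_mul]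
  nlinarith [sq_nonneg c, measureReal_nonneg (μ := μ) (s := Set.univ),
    mul_nonneg (measureReal_nonneg (μ := μ) (s := Set.univ)) (sq_nonneg c)]

lemma enorm_deriv_comp_affine_sq (f : ℝ → ℝ) (a d c t : ℝ) :
    ‖deriv (fun t => f (a + d * t) - c) t‖ₑ ^ 2 =
      ENNReal.ofReal (d ^ 2) * ‖deriv f (a + d * t)‖ₑ ^ 2 := by
  have h : deriv (fun t => f (a + d * t) - c) t = d * deriv f (a + d * t) := by
    rw [deriv_sub_const]
    have := deriv_comp_mul_left d (fun x => f (a + x)) t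
    rw [this, deriv_comp_const_add, smul_eq_mul]
  rw [h, enorm_mul, mul_pow, ← ofReal_abs_sq d, sq_abs]

lemma locallyLipschitz_comp_affine {f : ℝ → ℝ} (hf : LocallyLipschitz f) (a d : ℝ) :
    LocallyLipschitz fun t => f (a + d * t) := by
  refine hf.comp (LipschitzWith.locallyLipschitz (K := ‖d‖₊) ?_)
  refine LipschitzWith.of_dist_le_mul fun x y => ?_
  simp [Real.dist_eq, ← mul_sub, abs_mul]

lemma locallyLipschitz_sub {f g : ℝ → ℝ} (hf : LocallyLipschitz f) (hg : LocallyLipschitz g) :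
    LocallyLipschitz fun t => f t - g t :=
  (LipschitzWith.prod_fst.sub LipschitzWith.prod_snd : LipschitzWith _ fun p : ℝ × ℝ =>
    p.1 - p.2).locallyLipschitz.comp (hf.prodMk hg)

lemma HalfPoincare.le_poincareDensity {C : ℝ≥0∞} {K N D : ℝ} (hN : 1 < N) (hD : 0 < D)
    (h : HalfPoincare C (halfWeight K N D)) :
    C ≤ ENNReal.ofReal (D ^ 2) * poincareDensity (modelDensity K N D) := by
  have hfin := isFiniteMeasure_modelMeasure hN K D
  rw [poincareDensity_modelDensity, poincareConst]
  have hD2 : ENNReal.ofReal (D ^ 2) ≠ 0 := by simpa using hD.ne'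
  rw [mul_comm, ← ENNReal.div_le_iff hD2 ENNReal.ofReal_ne_top]
  refine le_iInf₂ fun f hf => ?_
  rw [ENNReal.le_div_iff_mul_le (Or.inl hf.sq_pos.ne') (Or.inl hf.sq_lt_top.ne),
    lintegral_locLipConst_modelMeasure hf.locallyLipschitz,
    ENNReal.div_eq_inv_mul, mul_assoc, ENNReal.inv_mul_le_iff hD2 ENNReal.ofReal_ne_top]
  have hf2 : Integrable (fun x => f x ^ 2) (modelMeasure K N D) :=
    integrable_modelMeasure hN K D (hf.locallyLipschitz.continuous.pow 2)
  -- The choices `d = D` and `d = -D` give the right and left halves; the chain rule produces the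
  -- factor `D ^ 2`.
  have half (d : ℝ) (hd : d ^ 2 = D ^ 2) :
      C * ∫⁻ t in Set.Ioo 0 (1 / 2), halfWeight K N D t * ‖f (D / 2 + d * t) - f (D / 2)‖ₑ ^ 2 ≤
      ENNReal.ofReal (D ^ 2) *
        ∫⁻ t in Set.Ioo 0 (1 / 2), halfWeight K N D t * ‖deriv f (D / 2 + d * t)‖ₑ ^ 2 := by
    have := h (fun t => f (D / 2 + d * t) - f (D / 2)) (locallyLipschitz_sub
      (locallyLipschitz_comp_affine hf.locallyLipschitz _ _) (LocallyLipschitz.const _)) (by simp)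
    refine this.trans_eq ?_
    rw [← lintegral_const_mul' _ _ ENNReal.ofReal_ne_top]
    refine lintegral_congr fun t => ?_
    rw [enorm_deriv_comp_affine_sq, hd]
    ring
  calc C * ∫⁻ x, ENNReal.ofReal (|f x| ^ 2) ∂modelMeasure K N D
      = C * ∫⁻ x, ‖f x‖ₑ ^ 2 ∂modelMeasure K N D := by simp only [ofReal_abs_sq]
    _ ≤ C * ∫⁻ x, ‖f x - f (D / 2)‖ₑ ^ 2 ∂modelMeasure K N D := by
        exact mul_le_mul_right (lintegral_enorm_sq_le_of_integral_eq_zero hf.integrable hf2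
          hf.integral_eq_zero _) _
    _ ≤ _ := by
        rw [lintegral_modelMeasure hN hD, lintegral_modelMeasure hN hD, mul_left_comm,
          mul_left_comm (ENNReal.ofReal (D ^ 2)), mul_add C, mul_add (ENNReal.ofReal (D ^ 2))]
        exact mul_le_mul_right (add_le_add (half D rfl) (half (-D) (by ring))) _

/-- The odd extension about the midpoint has mean zero, and each half contributes equally to both
integrals. -/
lemma halfPoincare_poincareDensity {K N D : ℝ} (hN : 1 < N) (hD : 0 < D) :
    HalfPoincare (ENNReal.ofReal (D ^ 2) * poincareDensity (modelDensity K N D))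
      (halfWeight K N D) := by
  intro g hg hg0
  -- This is the odd extension of `g`, since `g 0 = 0`; written without cases, it inherits local
  -- Lipschitz continuity by composition.
  set G : ℝ → ℝ := fun t => g (max t 0) - g (max (-t) 0) with hG
  have hGlip : LocallyLipschitz G :=
    locallyLipschitz_sub (hg.comp (LipschitzWith.id.max_const 0).locallyLipschitz)
      (hg.comp (LipschitzWith.id.neg.max_const 0).locallyLipschitz)
  have hGpos : ∀ t, 0 ≤ t → G t = g t := fun t ht => by
    simp [hG, max_eq_left ht, hg0, max_eq_right (neg_nonpos.2 ht)]
  have hGodd : ∀ t, G (-t) = -G t := fun t => by simp [hG]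
  set F : ℝ → ℝ := fun x => G (-(1 / 2) + D⁻¹ * x) with hF
  have hFlip : LocallyLipschitz F := locallyLipschitz_comp_affine hGlip _ _
  have hFodd : ∀ x, F (D - x) = -F x := fun x => by
    rw [hF, ← hGodd]
    dsimp only
    congr 1
    field_simp
    ring
  have hdF : ∀ x, ‖deriv F x‖ₑ ^ 2 =
      ENNReal.ofReal (D⁻¹ ^ 2) * ‖deriv G (-(1 / 2) + D⁻¹ * x)‖ₑ ^ 2 := fun x => by
    simpa [hF] using enorm_deriv_comp_affine_sq G (-(1 / 2)) D⁻¹ 0 x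
  have hR (t : ℝ) : -(1 / 2) + D⁻¹ * (D / 2 + D * t) = t := by field_simp; ring
  have hL (t : ℝ) : -(1 / 2) + D⁻¹ * (D / 2 + -D * t) = -t := by field_simp; ring
  have hdGodd (t : ℝ) : ‖deriv G (-t)‖ₑ = ‖deriv G t‖ₑ := by
    have h1 : deriv (fun t => G (-t)) t = -deriv G (-t) := deriv_comp_neg G t
    have h2 : deriv (fun t => G (-t)) t = -deriv G t := by
      rw [funext hGodd]; exact deriv.neg
    rw [h1] at h2
    rw [neg_injective h2]
  have hdGpos (t : ℝ) (ht : 0 < t) : deriv G t = deriv g t := by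
    refine EventuallyEq.deriv_eq ?_
    filter_upwards [Ioi_mem_nhds ht] with s hs using hGpos s (le_of_lt hs)
  have hsq : ∫⁻ x, ENNReal.ofReal (|F x| ^ 2) ∂modelMeasure K N D = ENNReal.ofReal D *
      (2 * ∫⁻ t in Set.Ioo 0 (1 / 2), halfWeight K N D t * ‖g t‖ₑ ^ 2) := by
    rw [lintegral_modelMeasure hN hD, two_mul]
    congr 2 <;> refine setLIntegral_congr_fun measurableSet_Ioo fun t ht => ?_
    · simp only [hF, ofReal_abs_sq, hR, hGpos t ht.1.le]
    · simp only [hF, ofReal_abs_sq, hL, hGodd, enorm_neg, hGpos t ht.1.le]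
  have hen : ∫⁻ x, locLipConst F x ^ 2 ∂modelMeasure K N D = ENNReal.ofReal D *
      (2 * (ENNReal.ofReal (D⁻¹ ^ 2) *
        ∫⁻ t in Set.Ioo 0 (1 / 2), halfWeight K N D t * ‖deriv g t‖ₑ ^ 2)) := by
    rw [lintegral_locLipConst_modelMeasure hFlip, lintegral_modelMeasure hN hD, two_mul,
      ← lintegral_const_mul' _ _ ENNReal.ofReal_ne_top]
    congr 2 <;> refine setLIntegral_congr_fun measurableSet_Ioo fun t ht => ?_
    · simp only [hdF, hR, hdGpos t ht.1]; ring
    · simp only [hdF, hL, hdGodd, hdGpos t ht.1]; ring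
  have hD1 : ENNReal.ofReal D ≠ 0 := by simpa using hD
  -- With zero norm `F` is not an admissible test function, but the inequality is then trivial.
  rcases eq_or_ne (∫⁻ t in Set.Ioo 0 (1 / 2), halfWeight K N D t * ‖g t‖ₑ ^ 2) 0 with h0 | h0
  · rw [h0, mul_zero]
    exact zero_le
  have hFc := hFlip.continuous
  have htest : IsPoincareTest (modelMeasure K N D) F := by
    refine ⟨hFlip, integrable_modelMeasure hN K D hFc, integral_eq_zero_of_reflect hN K D hFodd,
      ?_, ?_⟩
    · rw [hsq]
      exact pos_iff_ne_zero.2 (mul_ne_zero hD1 (mul_ne_zero two_ne_zero h0))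
    · simp only [ofReal_abs_sq]
      rw [lintegral_enorm_sq_eq (integrable_modelMeasure hN K D (hFc.pow 2))]
      exact ENNReal.ofReal_lt_top
  have hle : poincareDensity (modelDensity K N D) ≤ _ :=
    iInf₂_le (f := fun (f : ℝ → ℝ) (_ : IsPoincareTest (modelMeasure K N D) f) =>
      (∫⁻ x, locLipConst f x ^ 2 ∂modelMeasure K N D) /
        ∫⁻ x, ENNReal.ofReal (|f x| ^ 2) ∂modelMeasure K N D) F htest
  rw [ENNReal.le_div_iff_mul_le (Or.inl htest.sq_pos.ne') (Or.inl htest.sq_lt_top.ne),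
    hsq, hen, mul_left_comm, mul_left_comm _ 2,
    ENNReal.mul_le_mul_iff_right hD1 ENNReal.ofReal_ne_top,
    ENNReal.mul_le_mul_iff_right two_ne_zero ENNReal.ofNat_ne_top] at hle
  calc _ = ENNReal.ofReal (D ^ 2) * (poincareDensity (modelDensity K N D) *
        ∫⁻ t in Set.Ioo 0 (1 / 2), halfWeight K N D t * ‖g t‖ₑ ^ 2) := by ring
    _ ≤ _ := mul_le_mul_right hle _
    _ = _ := by
        rw [← mul_assoc, ← ENNReal.ofReal_mul (sq_nonneg D), ← mul_pow, mul_inv_cancel₀ hD.ne']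
        simp

/-! ### Comparison of two lengths through the ratio of their weights. -/

/-- The weight for `E` is that for `D` times a power of the ratio. No order between `D` and `E` is
imposed, so both signs of `K` are covered. -/
lemma poincareDensity_le_of_ratio_antitoneOn {K N D E : ℝ} (hN : 1 < N) (hD : 0 < D) (hE : 0 < E)
    (hpos : ∀ τ ∈ Set.Ioo (0 : ℝ) 1, 0 < sFun (K / (N - 1)) (D * τ))
    (hnonneg : ∀ τ ∈ Set.Ioo (0 : ℝ) 1, 0 ≤ sFun (K / (N - 1)) (E * τ))
    (hanti : AntitoneOn (fun τ => sFun (K / (N - 1)) (E * τ) / sFun (K / (N - 1)) (D * τ))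
      (Set.Ioo 0 1)) :
    ENNReal.ofReal (D ^ 2) * poincareDensity (modelDensity K N D) ≤
      ENNReal.ofReal (E ^ 2) * poincareDensity (modelDensity K N E) := by
  have hmem : ∀ t ∈ Set.Ioo (0 : ℝ) (1 / 2), 1 / 2 + t ∈ Set.Ioo (0 : ℝ) 1 := fun t ht =>
    ⟨by linarith [ht.1], by linarith [ht.2]⟩
  refine HalfPoincare.le_poincareDensity hN hE ?_
  refine ((halfPoincare_poincareDensity hN hD).antitone_mul (measurable_halfWeight hN K D)
    (φ := fun t => (sFun (K / (N - 1)) (E * (1 / 2 + t)) /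
      sFun (K / (N - 1)) (D * (1 / 2 + t))) ^ (N - 1)) ?_ ?_).congr ?_
  · intro s hs t ht hst
    refine Real.rpow_le_rpow (div_nonneg (hnonneg _ (hmem t ht)) (hpos _ (hmem t ht)).le) ?_
      (by linarith)
    exact hanti (hmem s hs) (hmem t ht) (by linarith)
  · intro t ht
    exact Real.rpow_nonneg (div_nonneg (hnonneg _ (hmem t ht)) (hpos _ (hmem t ht)).le) _
  · intro t ht
    have hp := hpos _ (hmem t ht)
    have hn := hnonneg _ (hmem t ht)
    simp only [halfWeight]
    rw [← ENNReal.ofReal_mul (Real.rpow_nonneg (div_nonneg hn hp.le) _),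
      ← Real.mul_rpow (div_nonneg hn hp.le) hp.le, div_mul_cancel₀ _ hp.ne']

/-- The numerator `W` of the derivative of the quotient is a Wronskian: it vanishes at `0`, and the
equation `y'' = -c² y` gives its derivative the sign of `a² - b²`. -/
lemma antitoneOn_sin_div_sin {a b : ℝ} (ha : 0 < a) (hab : a ≤ b) (hb : b ≤ Real.pi) :
    AntitoneOn (fun τ => Real.sin (b * τ) / Real.sin (a * τ)) (Set.Ioo 0 1) := by
  have hsa : ∀ τ ∈ Set.Ioo (0 : ℝ) 1, 0 < Real.sin (a * τ) := fun τ hτ =>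
    Real.sin_pos_of_pos_of_lt_pi (mul_pos ha hτ.1) (by nlinarith [hτ.1, hτ.2])
  have hsb : ∀ τ ∈ Set.Ioo (0 : ℝ) 1, 0 < Real.sin (b * τ) := fun τ hτ =>
    Real.sin_pos_of_pos_of_lt_pi (mul_pos (ha.trans_le hab) hτ.1)
      (by nlinarith [hτ.1, hτ.2])
  have hd (c x : ℝ) : HasDerivAt (fun x => Real.sin (c * x)) (Real.cos (c * x) * c) x := by
    simpa using ((hasDerivAt_id x).const_mul c).sin
  have hd' (c x : ℝ) : HasDerivAt (fun x => Real.cos (c * x)) (-Real.sin (c * x) * c) x := by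
    simpa using ((hasDerivAt_id x).const_mul c).cos
  set W : ℝ → ℝ := fun x => Real.cos (b * x) * b * Real.sin (a * x) -
    Real.sin (b * x) * (Real.cos (a * x) * a) with hW
  have hWd (x : ℝ) : HasDerivAt W ((a ^ 2 - b ^ 2) * (Real.sin (b * x) * Real.sin (a * x))) x := by
    refine ((((hd' b x).mul_const b).mul (hd a x)).sub
      ((hd b x).mul ((hd' a x).mul_const a))).congr_deriv ?_
    ring
  have hWanti : AntitoneOn W (Set.Icc 0 1) := by
    refine antitoneOn_of_deriv_nonpos (convex_Icc 0 1)
      (fun x _ => (hWd x).continuousAt.continuousWithinAt)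
      (fun x _ => (hWd x).differentiableAt.differentiableWithinAt) fun x hx => ?_
    rw [interior_Icc] at hx
    rw [(hWd x).deriv]
    exact mul_nonpos_of_nonpos_of_nonneg (by nlinarith) (mul_pos (hsb x hx) (hsa x hx)).le
  have hq (x : ℝ) (hx : x ∈ Set.Ioo (0 : ℝ) 1) :=
    (hd b x).div (hd a x) (hsa x hx).ne'
  refine antitoneOn_of_deriv_nonpos (convex_Ioo 0 1)
    (fun x hx => (hq x hx).continuousAt.continuousWithinAt)
    (fun x hx => (hq x (interior_subset hx)).differentiableAt.differentiableWithinAt) fun x hx => ?_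
  rw [interior_Ioo] at hx
  refine (hq x hx).deriv.trans_le (div_nonpos_of_nonpos_of_nonneg ?_ (sq_nonneg _))
  have := hWanti (Set.left_mem_Icc.2 zero_le_one) ⟨hx.1.le, hx.2.le⟩ hx.1.le
  simpa [hW] using this

/-- The same Wronskian argument; since now `y'' = c² y`, the smaller frequency sits in the
numerator. -/
lemma antitoneOn_sinh_div_sinh {a b : ℝ} (ha : 0 < a) (hab : a ≤ b) :
    AntitoneOn (fun τ => Real.sinh (a * τ) / Real.sinh (b * τ)) (Set.Ioo 0 1) := by
  have hsa : ∀ τ ∈ Set.Ioo (0 : ℝ) 1, 0 < Real.sinh (a * τ) := fun τ hτ =>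
    Real.sinh_pos_iff.2 (mul_pos ha hτ.1)
  have hsb : ∀ τ ∈ Set.Ioo (0 : ℝ) 1, 0 < Real.sinh (b * τ) := fun τ hτ =>
    Real.sinh_pos_iff.2 (mul_pos (ha.trans_le hab) hτ.1)
  have hd (c x : ℝ) : HasDerivAt (fun x => Real.sinh (c * x)) (Real.cosh (c * x) * c) x := by
    simpa using ((hasDerivAt_id x).const_mul c).sinh
  have hd' (c x : ℝ) : HasDerivAt (fun x => Real.cosh (c * x)) (Real.sinh (c * x) * c) x := by
    simpa using ((hasDerivAt_id x).const_mul c).cosh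
  set W : ℝ → ℝ := fun x => Real.cosh (a * x) * a * Real.sinh (b * x) -
    Real.sinh (a * x) * (Real.cosh (b * x) * b) with hW
  have hWd (x : ℝ) :
      HasDerivAt W ((a ^ 2 - b ^ 2) * (Real.sinh (b * x) * Real.sinh (a * x))) x := by
    refine ((((hd' a x).mul_const a).mul (hd b x)).sub
      ((hd a x).mul ((hd' b x).mul_const b))).congr_deriv ?_
    ring
  have hWanti : AntitoneOn W (Set.Icc 0 1) := by
    refine antitoneOn_of_deriv_nonpos (convex_Icc 0 1)
      (fun x _ => (hWd x).continuousAt.continuousWithinAt)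
      (fun x _ => (hWd x).differentiableAt.differentiableWithinAt) fun x hx => ?_
    rw [interior_Icc] at hx
    rw [(hWd x).deriv]
    exact mul_nonpos_of_nonpos_of_nonneg (by nlinarith) (mul_pos (hsb x hx) (hsa x hx)).le
  have hq (x : ℝ) (hx : x ∈ Set.Ioo (0 : ℝ) 1) :=
    (hd a x).div (hd b x) (hsb x hx).ne'
  refine antitoneOn_of_deriv_nonpos (convex_Ioo 0 1)
    (fun x hx => (hq x hx).continuousAt.continuousWithinAt)
    (fun x hx => (hq x (interior_subset hx)).differentiableAt.differentiableWithinAt) fun x hx => ?_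
  rw [interior_Ioo] at hx
  refine (hq x hx).deriv.trans_le (div_nonpos_of_nonpos_of_nonneg ?_ (sq_nonneg _))
  have := hWanti (Set.left_mem_Icc.2 zero_le_one) ⟨hx.1.le, hx.2.le⟩ hx.1.le
  simpa [hW] using this

lemma sFun_pos_of_nonpos {κ θ : ℝ} (hκ : κ ≤ 0) (hθ : 0 < θ) : 0 < sFun κ θ := by
  unfold sFun
  rw [if_neg hκ.not_gt]
  split_ifs with h
  · exact hθ
  · have : 0 < √(-κ) := Real.sqrt_pos.2 (by grind)
    have : 0 < Real.sinh (√(-κ) * θ) := Real.sinh_pos_iff.2 (mul_pos this hθ)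
    positivity

lemma sFun_monotone_of_nonpos {κ : ℝ} (hκ : κ ≤ 0) : Monotone (sFun κ) := by
  intro x y hxy
  unfold sFun
  rw [if_neg hκ.not_gt, if_neg hκ.not_gt]
  split_ifs with h
  · exact hxy
  · have : Real.sinh (√(-κ) * x) ≤ Real.sinh (√(-κ) * y) :=
      Real.sinh_le_sinh.2 (by gcongr)
    gcongr

lemma antitoneOn_sFun_ratio_of_nonpos {κ D E : ℝ} (hκ : κ ≤ 0) (hD : 0 < D) (hDE : D ≤ E) :
    AntitoneOn (fun τ => sFun κ (D * τ) / sFun κ (E * τ)) (Set.Ioo 0 1) := by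
  rcases hκ.eq_or_lt with rfl | hκ
  · intro s hs t ht _
    have hs := hs.1
    have ht := ht.1
    have hE := hD.trans_le hDE
    simp only [sFun, lt_irrefl, if_false, if_true]
    rw [mul_div_mul_right _ _ hs.ne', mul_div_mul_right _ _ ht.ne']
  · have hr : 0 < √(-κ) := Real.sqrt_pos.2 (by linarith)
    have := antitoneOn_sinh_div_sinh (mul_pos hr hD) (mul_le_mul_of_nonneg_left hDE hr.le)
    refine this.congr fun τ _ => ?_
    simp only [sFun, if_neg hκ.not_gt, if_neg hκ.ne]
    rw [mul_div_mul_left _ _ (by positivity), mul_assoc, mul_assoc]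

lemma antitoneOn_sFun_ratio_of_pos {κ D E : ℝ} (hκ : 0 < κ) (hD : 0 < D) (hDE : D ≤ E)
    (hE : √κ * E ≤ Real.pi) :
    AntitoneOn (fun τ => sFun κ (E * τ) / sFun κ (D * τ)) (Set.Ioo 0 1) := by
  have hr : 0 < √κ := Real.sqrt_pos.2 hκ
  have := antitoneOn_sin_div_sin (mul_pos hr hD) (mul_le_mul_of_nonneg_left hDE hr.le) hE
  refine this.congr fun τ _ => ?_
  simp only [sFun, if_pos hκ]
  rw [mul_div_mul_left _ _ (by positivity), mul_assoc, mul_assoc]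

lemma sFun_pos_of_pos {κ θ : ℝ} (hκ : 0 < κ) (hθ : 0 < θ) (hθ' : √κ * θ < Real.pi) :
    0 < sFun κ θ := by
  have hr : 0 < √κ := Real.sqrt_pos.2 hκ
  have := Real.sin_pos_of_pos_of_lt_pi (mul_pos hr hθ) hθ'
  rw [sFun, if_pos hκ]
  positivity

/-! ### Positivity and finiteness of the Poincaré constant. -/

/-- A function vanishing at `0` is controlled by its derivative on `(0, 1/2)`. -/
lemma lintegral_enorm_sq_le_deriv {f : ℝ → ℝ} (hf : LocallyLipschitz f) (hf0 : f 0 = 0) {t : ℝ}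
    (ht : t ∈ Set.Ioo (0 : ℝ) (1 / 2)) :
    ‖f t‖ₑ ^ 2 ≤ ∫⁻ s in Set.Ioo 0 (1 / 2), ‖deriv f s‖ₑ ^ 2 := by
  obtain ⟨C, hC⟩ := hf.exists_lipschitzOnWith_Icc 0 t
  rw [← Set.uIcc_of_le ht.1.le] at hC
  have hint := hC.absolutelyContinuousOnInterval.integral_deriv_eq_sub
  rw [hf0, sub_zero, intervalIntegral.integral_of_le ht.1.le] at hint
  have h1 : ‖f t‖ₑ ≤ ∫⁻ s in Set.Ioo 0 (1 / 2), ‖deriv f s‖ₑ := by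
    rw [← hint]
    exact (enorm_integral_le_lintegral_enorm _).trans
      (lintegral_mono_set fun s hs => ⟨hs.1, hs.2.trans_lt ht.2⟩)
  have hm := (measurable_deriv f).enorm
  -- Cauchy–Schwarz against the constant `1`; the factor from the interval length is at most `1` and
  -- is dropped.
  have h2 := ENNReal.lintegral_mul_le_Lp_mul_Lq (volume.restrict (Set.Ioo (0 : ℝ) (1 / 2)))
    Real.HolderConjugate.two_two hm.aemeasurable (aemeasurable_const (b := (1 : ℝ≥0∞)))
  simp only [Pi.mul_apply, mul_one, lintegral_const, one_pow, one_mul,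
    Measure.restrict_apply_univ, Real.volume_Ioo, sub_zero, ENNReal.rpow_two] at h2
  have h3 : ENNReal.ofReal (1 / 2) ^ (1 / 2 : ℝ) ≤ 1 :=
    ENNReal.rpow_le_one (by simp)
      (by norm_num)
  have h4 : ‖f t‖ₑ ≤ (∫⁻ s in Set.Ioo 0 (1 / 2), ‖deriv f s‖ₑ ^ 2) ^ (1 / 2 : ℝ) :=
    h1.trans (h2.trans (mul_le_of_le_one_right' h3))
  calc ‖f t‖ₑ ^ 2 ≤ ((∫⁻ s in Set.Ioo 0 (1 / 2), ‖deriv f s‖ₑ ^ 2) ^ (1 / 2 : ℝ)) ^ 2 := by gcongr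
    _ = _ := by
        rw [← ENNReal.rpow_two, ← ENNReal.rpow_mul]
        norm_num

lemma halfPoincare_of_bounds {u : ℝ → ℝ≥0∞} {m M : ℝ≥0∞} (hM : M ≠ ∞)
    (hM0 : M ≠ 0)
    (hu : ∀ t ∈ Set.Ioo (0 : ℝ) (1 / 2), m ≤ u t ∧ u t ≤ M) : HalfPoincare (m / M) u := by
  intro f hf hf0
  set A := ∫⁻ s in Set.Ioo 0 (1 / 2), ‖deriv f s‖ₑ ^ 2 with hA
  have hm : Measurable fun s => ‖deriv f s‖ₑ ^ 2 := (measurable_deriv f).enorm.pow_const 2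
  have h1 : ∫⁻ t in Set.Ioo 0 (1 / 2), u t * ‖f t‖ₑ ^ 2 ≤ M * A := by
    calc _ ≤ ∫⁻ t in Set.Ioo (0 : ℝ) (1 / 2), M * A :=
          setLIntegral_mono' measurableSet_Ioo fun t ht => by
            gcongr
            exacts [(hu t ht).2, lintegral_enorm_sq_le_deriv hf hf0 ht]
      _ ≤ M * A := by
          rw [setLIntegral_const, Real.volume_Ioo]
          refine mul_le_of_le_one_right' ?_
          simp
  calc _ ≤ m / M * (M * A) := by gcongr
    _ = m * A := by rw [← mul_assoc, ENNReal.div_mul_cancel hM0 hM]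
    _ ≤ _ := by
        rw [hA, ← lintegral_const_mul _ hm]
        exact setLIntegral_mono' measurableSet_Ioo fun t ht => by gcongr; exact (hu t ht).1

/-- The identity function has positive weighted norm and finite energy, which rules out an infinite
constant. -/
lemma HalfPoincare.ne_top_of_bounds {u : ℝ → ℝ≥0∞} {C m M : ℝ≥0∞} (h : HalfPoincare C u)
    (hm : m ≠ 0) (hM : M ≠ ∞)
    (hu : ∀ t ∈ Set.Ioo (0 : ℝ) (1 / 2), m ≤ u t ∧ u t ≤ M) : C ≠ ∞ := by
  rintro rfl
  have key := h id LocallyLipschitz.id rfl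
  have h1 : ∫⁻ t in Set.Ioo 0 (1 / 2), u t * ‖deriv id t‖ₑ ^ 2 ≤ M := by
    calc _ ≤ ∫⁻ t in Set.Ioo (0 : ℝ) (1 / 2), M :=
          setLIntegral_mono' measurableSet_Ioo fun t ht => by simpa using (hu t ht).2
      _ ≤ M := by
          rw [setLIntegral_const, Real.volume_Ioo]
          refine mul_le_of_le_one_right' ?_
          simp
  have h2 : 0 < ∫⁻ t in Set.Ioo 0 (1 / 2), u t * ‖id t‖ₑ ^ 2 := by
    refine lt_of_lt_of_le ?_ (setLIntegral_mono' (f := fun t => m * ‖t‖ₑ ^ 2) measurableSet_Ioo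
      fun t ht => by dsimp only [id]; gcongr; exact (hu t ht).1)
    rw [lintegral_const_mul _ (by fun_prop)]
    refine ENNReal.mul_pos hm ?_
    rw [← pos_iff_ne_zero, setLIntegral_pos_iff (by fun_prop)]
    refine lt_of_lt_of_le ?_ (measure_mono (s := Set.Ioo (0 : ℝ) (1 / 2)) fun t ht =>
      ⟨by simpa using ht.1.ne', ht⟩)
    simp
  rw [ENNReal.top_mul h2.ne'] at key
  exact hM (top_le_iff.1 (key.trans h1))

/-- For `K ≤ 0`, `sFun` is monotone, so the half weight lies between its positive values at the
midpoint and the endpoint. -/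
lemma poincareDensity_pos_lt_top {K N D : ℝ} (hN : 1 < N) (hK : K ≤ 0) (hD : 0 < D) :
    0 < poincareDensity (modelDensity K N D) ∧ poincareDensity (modelDensity K N D) ≠ ∞ := by
  have hκ : K / (N - 1) ≤ 0 := div_nonpos_of_nonpos_of_nonneg hK (by linarith)
  set κ := K / (N - 1)
  have hN' : 0 ≤ N - 1 := by linarith
  have hD2 := sFun_pos_of_nonpos hκ (half_pos hD)
  have hD1 := sFun_pos_of_nonpos hκ hD
  set m := ENNReal.ofReal (sFun κ (D / 2) ^ (N - 1))
  set M := ENNReal.ofReal (sFun κ D ^ (N - 1))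
  have hm : m ≠ 0 := (ENNReal.ofReal_pos.2 (Real.rpow_pos_of_pos hD2 _)).ne'
  have hM0 : M ≠ 0 := (ENNReal.ofReal_pos.2 (Real.rpow_pos_of_pos hD1 _)).ne'
  have hu : ∀ t ∈ Set.Ioo (0 : ℝ) (1 / 2), m ≤ halfWeight K N D t ∧ halfWeight K N D t ≤ M := by
    intro t ht
    have h1 : D / 2 ≤ D * (1 / 2 + t) := by nlinarith [ht.1]
    have h2 : D * (1 / 2 + t) ≤ D := by nlinarith [ht.2]
    have h3 := sFun_monotone_of_nonpos hκ h1
    exact ⟨ENNReal.ofReal_le_ofReal (Real.rpow_le_rpow hD2.le h3 hN'),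
      ENNReal.ofReal_le_ofReal (Real.rpow_le_rpow (hD2.le.trans h3)
        (sFun_monotone_of_nonpos hκ h2) hN')⟩
  have hDsq : ENNReal.ofReal (D ^ 2) ≠ 0 := by simpa using hD.ne'
  constructor
  · have h := (halfPoincare_of_bounds ENNReal.ofReal_ne_top hM0 hu).le_poincareDensity hN hD
    refine pos_iff_ne_zero.2 fun h0 => ?_
    rw [h0, mul_zero, nonpos_iff_eq_zero, ENNReal.div_eq_zero_iff] at h
    exact h.elim hm ENNReal.ofReal_ne_top
  · intro htop
    refine (halfPoincare_poincareDensity (K := K) hN hD).ne_top_of_bounds hm ENNReal.ofReal_ne_top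
      hu ?_
    rw [htop, ENNReal.mul_top hDsq]

/-! ### Monotonicity in the length. -/

lemma antitoneOn_sq_mul_poincareDensity {K N : ℝ} (hN : 1 < N) (hK : K ≤ 0) :
    AntitoneOn (fun D : ℝ => ENNReal.ofReal (D ^ 2) * poincareDensity (modelDensity K N D))
      (lengthRange K N) := by
  intro D hD E hE hDE
  have hκ : K / (N - 1) ≤ 0 := div_nonpos_of_nonpos_of_nonneg hK (by linarith)
  exact poincareDensity_le_of_ratio_antitoneOn hN hE.1 hD.1
    (fun τ hτ => sFun_pos_of_nonpos hκ (mul_pos hE.1 hτ.1))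
    (fun τ hτ => (sFun_pos_of_nonpos hκ (mul_pos hD.1 hτ.1)).le)
    (antitoneOn_sFun_ratio_of_nonpos hκ hD.1 hDE)

lemma monotoneOn_sq_mul_poincareDensity {K N : ℝ} (hN : 1 < N) (hK : 0 ≤ K) :
    MonotoneOn (fun D : ℝ => ENNReal.ofReal (D ^ 2) * poincareDensity (modelDensity K N D))
      (lengthRange K N) := by
  intro D hD E hE hDE
  rcases hK.eq_or_lt with rfl | hK
  · refine poincareDensity_le_of_ratio_antitoneOn hN hD.1 hE.1 ?_ ?_ ?_
    · exact fun τ hτ => sFun_pos_of_nonpos (by simp) (mul_pos hD.1 hτ.1)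
    · exact fun τ hτ => (sFun_pos_of_nonpos (by simp) (mul_pos hE.1 hτ.1)).le
    · intro s hs t ht _
      simp only [zero_div, sFun, lt_irrefl, if_false, if_true]
      rw [mul_div_mul_right _ _ hs.1.ne', mul_div_mul_right _ _ ht.1.ne']
  · have hκ : 0 < K / (N - 1) := div_pos hK (by linarith)
    have hr : 0 < √(K / (N - 1)) := Real.sqrt_pos.2 hκ
    have hEle : √(K / (N - 1)) * E ≤ Real.pi := by
      have h := hE.2
      rw [bonnetMyers, if_pos hK, EReal.coe_le_coe_iff, le_div_iff₀ hr] at h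
      linarith
    have hpos {F : ℝ} (hF : 0 < F) (hFE : F ≤ E) (τ : ℝ) (hτ : τ ∈ Set.Ioo (0 : ℝ) 1) :
        0 < sFun (K / (N - 1)) (F * τ) := by
      refine sFun_pos_of_pos hκ (mul_pos hF hτ.1) (lt_of_lt_of_le ?_ hEle)
      exact mul_lt_mul_of_pos_left (by nlinarith [hτ.2]) hr
    exact poincareDensity_le_of_ratio_antitoneOn hN hD.1 hE.1 (hpos hD.1 hDE)
      (fun τ hτ => (hpos hE.1 le_rfl τ hτ).le) (antitoneOn_sFun_ratio_of_pos hκ hD.1 hDE hEle)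

theorem lemma4p8 (K N : ℝ) (hN : 1 < N) :
    (K ≤ 0 → AntitoneOn
      (fun D : ℝ => ENNReal.ofReal (D ^ 2) * poincareDensity (modelDensity K N D))
      (lengthRange K N)) ∧
    (0 ≤ K → MonotoneOn
      (fun D : ℝ => ENNReal.ofReal (D ^ 2) * poincareDensity (modelDensity K N D))
      (lengthRange K N)) ∧
    (K = 0 → ∃ c : ℝ≥0∞, ∀ D ∈ lengthRange K N,
      ENNReal.ofReal (D ^ 2) * poincareDensity (modelDensity K N D) = c) ∧
    (K ≤ 0 → StrictAntiOn
      (fun D : ℝ => poincareDensity (modelDensity K N D))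
      (lengthRange K N)) := by
  refine ⟨antitoneOn_sq_mul_poincareDensity hN, monotoneOn_sq_mul_poincareDensity hN, ?_, ?_⟩
  · rintro rfl
    have h1 : (1 : ℝ) ∈ lengthRange 0 N := by simp [lengthRange, bonnetMyers]
    have hmono := monotoneOn_sq_mul_poincareDensity hN (le_refl 0)
    have hanti := antitoneOn_sq_mul_poincareDensity hN (le_refl 0)
    refine ⟨ENNReal.ofReal (1 ^ 2) * poincareDensity (modelDensity 0 N 1), fun D hD => ?_⟩
    rcases le_total D 1 with h | h
    exacts [(hmono hD h1 h).antisymm (hanti hD h1 h), (hanti h1 hD h).antisymm (hmono h1 hD h)]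
  · intro hK D hD E hE hDE
    have h := antitoneOn_sq_mul_poincareDensity hN hK hD hE hDE.le
    obtain ⟨hpos, htop⟩ := poincareDensity_pos_lt_top hN hK hD.1
    -- If `λ` did not drop from `D` to `E`, then `D² λ(D) < E² λ(D) ≤ E² λ(E)`, against `h`; the
    -- strict step needs `λ(D)` positive and finite.
    refine lt_of_not_ge fun hge => absurd h (not_le.2 ?_)
    have hsq : ENNReal.ofReal (D ^ 2) < ENNReal.ofReal (E ^ 2) :=
      (ENNReal.ofReal_lt_ofReal_iff (by have := hE.1; positivity)).2
        (by have := hD.1; gcongr)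
    calc _ < ENNReal.ofReal (E ^ 2) * poincareDensity (modelDensity K N D) :=
          (ENNReal.mul_lt_mul_iff_left hpos.ne' htop).2 hsq
      _ ≤ _ := mul_le_mul_right hge _
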